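/- Let $\mathcal F$ be a signature (function symbols with fixed arities), $\mathcal V$ a countably infinite set of variables, and $S$ a set of sorts with a partial order $\succeq$. Let $\mathcal S$ be a sort attachment: it associates with each $f\in\mathcal F$ of arity $n$ a type $f:\alpha_1\times\cdots\times\alpha_n\to\alpha$ with $\alpha_i,\alpha\in S$, and with each variable a sort in $S$, such that for every $\alpha\in S$ the set $\mathcal V_\alpha$ of variables of sort $\alpha$ is countably infinite. The sets $\mathcal T_\alpha$ of order-sorted terms of sort $\alpha$ are defined inductively: $\mathcal V_\alpha\subseteq\mathcal T_\alpha$, and $f(t_1,\dots,t_n)\in\mathcal T_\alpha$ whenever $f:\alpha_1\times\cdots\times\alpha_n\to\alpha$, $t_i\in\mathcal T_{\beta_i}$ and $\alpha_i\succeq\beta_i$ for all $i$. Put $\mathcal T_{\mathcal S}=\bigcup_{\alpha\in S}\mathcal T_\alpha$. A term $t$ is strictly order-sorted if, whenever $f(t_1,\dots,t_n)$ with $f:\alpha_1\times\cdots\times\alpha_n\to\alpha$ is a subterm of $t$ and $t_i$ is a variable of sort $\beta$, then $\alpha_i=\beta$. Let $\mathcal R$ be a term rewrite system over $\mathcal F$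 and $\mathcal V$, i.e. a set of rules $\ell\to r$ between terms such that $\ell$ is not a variable and every variable of $r$ occurs in $\ell$. Suppose that $\mathcal R$ is compatible with $\mathcal S$: for every rule $\ell\to r$ of $\mathcal R$ both sides are order-sorted, say $\ell\in\mathcal T_\alpha$ and $r\in\mathcal T_\beta$, with $\alpha\succeq\beta$, and $\ell$ is strictly order-sorted. Suppose also that $\mathcal R$ is left-linear, i.e. no variable occurs more than once in the left-hand side of a rule. If $\mathcal R$ is confluent on $\mathcal T_{\mathcal S}$ (that is, $\mathcal T_{\mathcal S}$ is closed under $\to_{\mathcal R}$ and the restriction of $\to_{\mathcal R}$ to $\mathcal T_{\mathcal S}$ is confluent), then $\mathcal R$ is confluent on all terms. -/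

import Mathlib

/-!
First-order term rewriting and order-sorted terms.

A signature is a `FirstOrder.Language` (only its function symbols, which carry their arity,
matter), and `L.Term V` is the set of terms over the function symbols of `L` and the variables `V`.
Substitutions are maps `V → L.Term V`, applied by `FirstOrder.Language.Term.subst`.
-/

universe u v w z

namespace OrderSorted

open FirstOrder FirstOrder.Language

section Rewriting

variable {L : FirstOrder.Language.{u, v}} {V : Type w}

/-- The set of variables that occur in a term. -/
def vars : L.Term V → Set V
  | .var x => {x}
  | .func _ ts => ⋃ i, vars (ts i)

open Classical in
/-- The number of occurrences of the variable `x` in a term. -/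
noncomputable def occ (x : V) : L.Term V → ℕ
  | .var y => if y = x then 1 else 0
  | .func _ ts => ∑ i, occ x (ts i)

/-- A term is linear if every variable occurs at most once in it. -/
def Linear (t : L.Term V) : Prop := ∀ x, occ x t ≤ 1

variable (L V) in
/-- Rewrite rules `lhs → rhs`: the left-hand side is not a variable, and every variable of the
right-hand side occurs in the left-hand side. -/
structure Rule where
  lhs : L.Term V
  rhs : L.Term V
  lhs_ne_var : ∀ x : V, lhs ≠ Term.var x
  vars_rhs_subset : vars rhs ⊆ vars lhs

variable (L V) in
/-- A term rewrite system over a fixed signature is an arbitrary set of rewrite rules. -/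
abbrev TRS := Set (Rule L V)

/-- A TRS is left-linear if all its left-hand sides are linear. -/
def LeftLinear (R : TRS L V) : Prop := ∀ ρ ∈ R, Linear ρ.lhs

/-- The rewrite relation: one instance of a left-hand side, at some position, is replaced by the
corresponding instance of the right-hand side. -/
inductive Step (R : TRS L V) : L.Term V → L.Term V → Prop
  | root (ρ : Rule L V) (hρ : ρ ∈ R) (σ : V → L.Term V) :
      Step R (ρ.lhs.subst σ) (ρ.rhs.subst σ)
  | arg {n : ℕ} (f : L.Functions n) (ts : Fin n → L.Term V) (i : Fin n) (u : L.Term V)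
      (h : Step R (ts i) u) :
      Step R (Term.func f ts) (Term.func f (Function.update ts i u))

end Rewriting

section Confluence

variable {A : Type z}

/-- A relation is confluent if any two elements reachable from a common element have a common
reduct. -/
def Confluent (r : A → A → Prop) : Prop :=
  ∀ a b c, Relation.ReflTransGen r a b → Relation.ReflTransGen r a c →
    ∃ d, Relation.ReflTransGen r b d ∧ Relation.ReflTransGen r c d

/-- A relation is confluent on a set `X` if `X` is closed under the relation and the restriction
of the relation to `X` is confluent. -/
def ConfluentOn (r : A → A → Prop) (X : Set A) : Prop :=
  (∀ a ∈ X, ∀ b, r a b → b ∈ X) ∧ Confluent (fun a b => r a b ∧ a ∈ X ∧ b ∈ X)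

end Confluence

section Sorts

/-- A sort attachment: every function symbol `f` of arity `n` gets a type
`argSort f 0 × ⋯ × argSort f (n - 1) → resSort f`, and every variable gets a sort. -/
structure SortAttachment (L : FirstOrder.Language.{u, v}) (V : Type w) (S : Type z) where
  argSort : ∀ {n : ℕ}, L.Functions n → Fin n → S
  resSort : ∀ {n : ℕ}, L.Functions n → S
  varSort : V → S

variable {L : FirstOrder.Language.{u, v}} {V : Type w} {S : Type z}

/-- The set of variables of sort `α`. -/
def SortAttachment.varsOfSort (𝒮 : SortAttachment L V S) (α : S) : Set V :=
  {x | 𝒮.varSort x = α}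

/-- A term is strictly order-sorted if every variable that occurs in it as an argument of a
function symbol has exactly the sort which that function symbol expects there. -/
def SortAttachment.StrictlySorted (𝒮 : SortAttachment L V S) : L.Term V → Prop
  | .var _ => True
  | .func f ts => ∀ i, (∀ x, ts i = Term.var x → 𝒮.argSort f i = 𝒮.varSort x) ∧
      𝒮.StrictlySorted (ts i)

variable [PartialOrder S]

/-- `𝒮.HasSort t α`: the term `t` is an order-sorted term of sort `α`. An argument may have any
sort below or equal to the sort that the function symbol expects. -/
inductive SortAttachment.HasSort (𝒮 : SortAttachment L V S) : L.Term V → S → Prop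
  | var (x : V) : 𝒮.HasSort (Term.var x) (𝒮.varSort x)
  | func {n : ℕ} (f : L.Functions n) (ts : Fin n → L.Term V) (β : Fin n → S)
      (hts : ∀ i, 𝒮.HasSort (ts i) (β i)) (hβ : ∀ i, β i ≤ 𝒮.argSort f i) :
      𝒮.HasSort (Term.func f ts) (𝒮.resSort f)

/-- The set of all order-sorted terms. -/
def SortAttachment.sortedTerms (𝒮 : SortAttachment L V S) : Set (L.Term V) :=
  {t | ∃ α, 𝒮.HasSort t α}

/-- A TRS is compatible with a sort attachment if both sides of every rule are order-sorted, the
sort of the left-hand side is above or equal to the sort of the right-hand side, and the left-hand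
side is strictly order-sorted. (A term has at most one sort.) -/
def SortAttachment.Compatible (𝒮 : SortAttachment L V S) (R : TRS L V) : Prop :=
  ∀ ρ ∈ R, ∃ α β, 𝒮.HasSort ρ.lhs α ∧ 𝒮.HasSort ρ.rhs β ∧ β ≤ α ∧ 𝒮.StrictlySorted ρ.lhs

end Sorts

end OrderSorted

/-!
Call an argument of a function symbol ill-sorted if its root sort is not below or equal to the
expected one, and let the rank of a term be the largest number of ill-sorted arguments on a path.
Strictness of the left-hand sides ensures that rewriting does not increase the rank: whatever a rule
moves was already ill-sorted in the left-hand side if it is ill-sorted with respect to the variable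
it is substituted for. As terms of rank `0` are order-sorted, it suffices to show that confluence of
the terms of rank at most `r` implies that of the terms of rank at most `r + 1`.

Cut a term of rank at most `r + 1` at its maximal ill-sorted arguments, and put sorted holes in
their place that remember what was cut out. If a hole counts as a variable whose weight is the rank
of its content, the outcome has rank at most `r`. As infinitely many variables of each sort are
available, holes can be renamed to variables, so the rewrite relation on hole terms of rank at most
`r` is confluent. By left-linearity it commutes with rewriting the contents of holes and dissolving
holes, and two such reductions are joinable because the contents have rank at most `r`; hence the
combined relation is confluent. Finally, each rewrite step on terms is simulated on hole terms: as
left-hand sides are order-sorted, the content of a hole that obstructs a redex fits where the hole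
stands, so dissolving the hole does not increase the rank.
-/

namespace OrderSorted

open FirstOrder FirstOrder.Language Relation

section AbstractRewriting

variable {A B : Type*}

/-- Confluence at a single element: any two elements reachable from `a` are joinable. -/
def ConfluentAt (r : A → A → Prop) (a : A) : Prop :=
  ∀ b c, ReflTransGen r a b → ReflTransGen r a c → Join (ReflTransGen r) b c

theorem ConfluentOn.confluentAt {r : A → A → Prop} {X : Set A} (h : ConfluentOn r X) {a : A}
    (ha : a ∈ X) : ConfluentAt r a := by
  have restrict : ∀ {b}, ReflTransGen r a b →
      b ∈ X ∧ ReflTransGen (fun a b => r a b ∧ a ∈ X ∧ b ∈ X) a b := by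
    intro b hb
    induction hb with
    | refl => exact ⟨ha, .refl⟩
    | tail _ hbc ih =>
      have hc := h.1 _ ih.1 _ hbc
      exact ⟨hc, ih.2.tail ⟨hbc, ih.1, hc⟩⟩
  intro b c hb hc
  obtain ⟨d, hbd, hcd⟩ := h.2 a b c (restrict hb).2 (restrict hc).2
  exact ⟨d, ReflTransGen.mono (fun _ _ h => h.1) _ _ hbd,
    ReflTransGen.mono (fun _ _ h => h.1) _ _ hcd⟩

theorem Confluent.confluentAt_of_simulation {r : A → A → Prop} {s : B → B → Prop} (g : B → A)
    (hs : Confluent s) (sound : ∀ x y, s x y → ReflTransGen r (g x) (g y))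
    (simulate : ∀ x a, r (g x) a → ∃ y, s x y ∧ g y = a) (x : B) : ConfluentAt r (g x) := by
  have lift : ∀ {a}, ReflTransGen r (g x) a → ∃ y, ReflTransGen s x y ∧ g y = a := by
    intro a ha
    induction ha with
    | refl => exact ⟨x, .refl, rfl⟩
    | tail _ hab ih =>
      obtain ⟨y, hxy, rfl⟩ := ih
      obtain ⟨z, hyz, rfl⟩ := simulate y _ hab
      exact ⟨z, hxy.tail hyz, rfl⟩
  intro a b ha hb
  obtain ⟨y, hxy, rfl⟩ := lift ha
  obtain ⟨z, hxz, rfl⟩ := lift hb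
  obtain ⟨w, hyw, hzw⟩ := hs x y z hxy hxz
  exact ⟨g w, ReflTransGen.lift' g sound _ _ hyw, ReflTransGen.lift' g sound _ _ hzw⟩

theorem confluent_comp_of_commute {p s : A → A → Prop}
    (trans : ∀ {a b c}, s a b → s b c → s a c)
    (diamond : ∀ {a b c}, s a b → s a c → ∃ d, s b d ∧ s c d)
    (commute : ∀ {a b c}, s a b → p a c → ∃ d, p b d ∧ s c d)
    (peak : ∀ {a b c}, p a b → p a c → ∃ d, Comp p s b d ∧ Comp p s c d) :
    Confluent (Comp p s) := by
  have strip : ∀ {a b c}, s a b → Comp p s a c → ∃ d, Comp p s b d ∧ s c d := by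
    rintro a b c hab ⟨m, ham, hmc⟩
    obtain ⟨k, hbk, hmk⟩ := commute hab ham
    obtain ⟨d, hkd, hcd⟩ := diamond hmk hmc
    exact ⟨d, ⟨k, hbk, hkd⟩, hcd⟩
  intro a b c hb hc
  refine church_rosser ?_ hb hc
  rintro a b c ⟨b₀, hab₀, hb₀b⟩ ⟨c₀, hac₀, hc₀c⟩
  obtain ⟨d, hb₀d, hc₀d⟩ := peak hab₀ hac₀
  obtain ⟨b₁, ⟨b₂, hbb₂, hb₂b₁⟩, hdb₁⟩ := strip hb₀b hb₀d
  obtain ⟨c₁, ⟨c₂, hcc₂, hc₂c₁⟩, hdc₁⟩ := strip hc₀c hc₀d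
  obtain ⟨e, hb₁e, hc₁e⟩ := diamond hdb₁ hdc₁
  exact ⟨e, .single ⟨b₂, hbb₂, trans hb₂b₁ hb₁e⟩, .single ⟨c₂, hcc₂, trans hc₂c₁ hc₁e⟩⟩

end AbstractRewriting

section Substitution

variable {L : FirstOrder.Language.{u, v}} {U V W : Type*}

theorem subst_congr {σ τ : V → L.Term W} :
    ∀ {t : L.Term V}, (∀ x ∈ vars t, σ x = τ x) → t.subst σ = t.subst τ
  | .var x, h => h x rfl
  | .func f _, h => congrArg (Term.func f) <| funext fun i =>
      subst_congr fun x hx => h x (Set.mem_iUnion.2 ⟨i, hx⟩)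

theorem subst_subst (σ : U → L.Term V) (τ : V → L.Term W) :
    ∀ t : L.Term U, (t.subst σ).subst τ = t.subst fun x => (σ x).subst τ
  | .var _ => rfl
  | .func f ts => congrArg (Term.func f) <| funext fun i => subst_subst σ τ (ts i)

theorem subst_var : ∀ t : L.Term V, t.subst Term.var = t
  | .var _ => rfl
  | .func f ts => congrArg (Term.func f) <| funext fun i => subst_var (ts i)

theorem subst_update {n : ℕ} (τ : V → L.Term W) (ts : Fin n → L.Term V) (i : Fin n)
    (u : L.Term V) : (fun j => (Function.update ts i u j).subst τ) =
      Function.update (fun j => (ts j).subst τ) i (u.subst τ) :=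
  Function.comp_update (fun t : L.Term V => t.subst τ) ts i u

theorem finite_vars : ∀ t : L.Term V, (vars t).Finite
  | .var x => Set.finite_singleton x
  | .func _ ts => Set.finite_iUnion fun i => finite_vars (ts i)

theorem mem_vars_subst {σ : V → L.Term W} {y : W} :
    ∀ {t : L.Term V}, y ∈ vars (t.subst σ) ↔ ∃ x ∈ vars t, y ∈ vars (σ x)
  | .var x => by simp [vars, Term.subst]
  | .func f ts => by
      simp only [Term.subst, vars, Set.mem_iUnion, mem_vars_subst]
      exact ⟨fun ⟨i, x, hx, hy⟩ => ⟨x, ⟨i, hx⟩, hy⟩, fun ⟨x, ⟨i, hx⟩, hy⟩ => ⟨i, x, hx, hy⟩⟩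

end Substitution

section Linear

variable {L : FirstOrder.Language.{u, v}} {V : Type*} {n : ℕ} {f : L.Functions n}
  {ts : Fin n → L.Term V}

theorem occ_arg_le_occ_func (f : L.Functions n) (ts : Fin n → L.Term V) (x : V) (i : Fin n) :
    occ x (ts i) ≤ occ x (Term.func f ts) :=
  Finset.single_le_sum (f := fun i => occ x (ts i)) (fun _ _ => Nat.zero_le _) (Finset.mem_univ i)

theorem one_le_occ {x : V} : ∀ {t : L.Term V}, x ∈ vars t → 1 ≤ occ x t
  | .var y, h => by obtain rfl : x = y := h; simp [occ]
  | .func f ts, h => by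
      obtain ⟨i, hi⟩ := Set.mem_iUnion.1 h
      exact (one_le_occ hi).trans (occ_arg_le_occ_func f ts x i)

theorem Linear.arg (h : Linear (Term.func f ts)) (i : Fin n) : Linear (ts i) := fun x =>
  (occ_arg_le_occ_func f ts x i).trans (h x)

theorem Linear.index_eq (h : Linear (Term.func f ts)) {x : V} {i j : Fin n}
    (hi : x ∈ vars (ts i)) (hj : x ∈ vars (ts j)) : i = j := by
  by_contra hij
  have hpair : ∑ k ∈ {i, j}, occ x (ts k) ≤ 1 :=
    (Finset.sum_le_sum_of_subset (Finset.subset_univ _)).trans (h x)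
  rw [Finset.sum_pair hij] at hpair
  have := one_le_occ hi
  have := one_le_occ hj
  omega

theorem Linear.exists_eqOn_vars {α : Type*} [Nonempty α] (h : Linear (Term.func f ts))
    (σ : Fin n → V → α) : ∃ τ : V → α, ∀ i, Set.EqOn τ (σ i) (vars (ts i)) := by
  classical
  refine ⟨fun x => if hx : ∃ i, x ∈ vars (ts i) then σ hx.choose x else Classical.arbitrary α,
    fun i x hi => ?_⟩
  have hx : ∃ j, x ∈ vars (ts j) := ⟨i, hi⟩
  simp only [dif_pos hx, h.index_eq hx.choose_spec hi]

end Linear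

section RelationalSubstitution

variable {L : FirstOrder.Language.{u, v}} {U V W : Type*} {B : V → L.Term W → Prop}

/-- Relational substitution: `u` arises from `t` by replacing every occurrence of a variable `x`,
independently of the other occurrences, by some term related to `x` by `B`. -/
def SubstRel (B : V → L.Term W → Prop) : L.Term V → L.Term W → Prop
  | .var x, u => B x u
  | .func f ts, u => ∃ us, u = Term.func f us ∧ ∀ i, SubstRel B (ts i) (us i)

theorem substRel_subst {σ : V → L.Term W} :
    ∀ {t : L.Term V}, (∀ x ∈ vars t, B x (σ x)) → SubstRel B t (t.subst σ)
  | .var x, h => h x rfl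
  | .func _ _, h => ⟨_, rfl, fun i => substRel_subst fun x hx => h x (Set.mem_iUnion.2 ⟨i, hx⟩)⟩

theorem substRel_refl {B : V → L.Term V → Prop} (h : ∀ x, B x (Term.var x)) (t : L.Term V) :
    SubstRel B t t := by
  simpa only [subst_var] using substRel_subst (t := t) fun x _ => h x

theorem subst_substRel_iff {σ : U → L.Term V} : ∀ {t : L.Term U} {u : L.Term W},
    SubstRel B (t.subst σ) u ↔ SubstRel (fun x => SubstRel B (σ x)) t u
  | .var _, _ => Iff.rfl
  | .func _ _, _ => by simp only [Term.subst, SubstRel, subst_substRel_iff]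

theorem SubstRel.exists_subst : ∀ {t : L.Term V} {u : L.Term W}, SubstRel B t u → Linear t →
    ∃ σ : V → L.Term W, u = t.subst σ ∧ ∀ x ∈ vars t, B x (σ x)
  | .var x, u, h, _ => ⟨fun _ => u, rfl, fun y hy => by obtain rfl : y = x := hy; exact h⟩
  | .func f ts, u, h, hl => by
      obtain ⟨us, rfl, hus⟩ := h
      choose σ hσ hB using fun i => SubstRel.exists_subst (hus i) (hl.arg i)
      have : Nonempty (L.Term W) := ⟨Term.func f us⟩
      obtain ⟨τ, hτ⟩ := hl.exists_eqOn_vars σ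
      refine ⟨τ, congrArg (Term.func f) <| funext fun i =>
        (hσ i).trans (subst_congr (hτ i)).symm, fun x hx => ?_⟩
      obtain ⟨i, hi⟩ := Set.mem_iUnion.1 hx
      rw [hτ i hi]
      exact hB i x hi

theorem SubstRel.update {B : V → L.Term V → Prop} (hB : ∀ x, B x (Term.var x)) {n : ℕ}
    (f : L.Functions n) (ts : Fin n → L.Term V) (i : Fin n) {u : L.Term V}
    (h : SubstRel B (ts i) u) :
    SubstRel B (Term.func f ts) (Term.func f (Function.update ts i u)) := by
  refine ⟨_, rfl, fun j => ?_⟩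
  rcases eq_or_ne j i with rfl | hj
  · rwa [Function.update_self]
  · rw [Function.update_of_ne hj]
    exact substRel_refl hB (ts j)

end RelationalSubstitution

section Steps

variable {L : FirstOrder.Language.{u, v}} {V : Type w} {U W X : Type*} {R : TRS L V}

/-- The rewrite relation that a system with rules over the variables `V` induces on the terms over
another set `W` of variables. -/
inductive StepOver (R : TRS L V) : L.Term W → L.Term W → Prop
  | root (ρ : Rule L V) (hρ : ρ ∈ R) (σ : V → L.Term W) :
      StepOver R (ρ.lhs.subst σ) (ρ.rhs.subst σ)
  | arg {n : ℕ} (f : L.Functions n) (ts : Fin n → L.Term W) (i : Fin n) (u : L.Term W)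
      (h : StepOver R (ts i) u) :
      StepOver R (Term.func f ts) (Term.func f (Function.update ts i u))

theorem stepOver_eq_step (R : TRS L V) : StepOver R = Step R := by
  ext t u
  constructor <;> intro h <;> induction h with
  | root ρ hρ σ => exact .root ρ hρ σ
  | arg f ts i u _ ih => exact .arg f ts i u ih

theorem StepOver.subst {t u : L.Term W} (h : StepOver R t u) (τ : W → L.Term X) :
    StepOver R (t.subst τ) (u.subst τ) := by
  induction h with
  | root ρ hρ σ =>
    rw [subst_subst, subst_subst]
    exact .root ρ hρ _
  | arg f ts i u _ ih =>
    simp only [Term.subst, subst_update]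
    exact .arg f _ i _ ih

theorem StepOver.vars_subset {t u : L.Term W} (h : StepOver R t u) : vars u ⊆ vars t := by
  induction h with
  | root ρ _ σ =>
    intro y hy
    obtain ⟨x, hx, hy⟩ := mem_vars_subst.1 hy
    exact mem_vars_subst.2 ⟨x, ρ.vars_rhs_subset hx, hy⟩
  | arg f ts i u _ ih =>
    refine Set.iUnion_subset fun j => ?_
    rcases eq_or_ne j i with rfl | hj
    · rw [Function.update_self]
      exact ih.trans (Set.subset_iUnion (fun j => vars (ts j)) j)
    · rw [Function.update_of_ne hj]
      exact Set.subset_iUnion (fun j => vars (ts j)) j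

theorem StepOver.exists_substRel (hll : LeftLinear R) {B : W → L.Term X → Prop} {t u : L.Term W}
    (h : StepOver R t u) :
    ∀ {t' : L.Term X}, SubstRel B t t' → ∃ u', StepOver R t' u' ∧ SubstRel B u u' := by
  induction h with
  | root ρ hρ σ =>
    intro t' ht
    obtain ⟨τ, rfl, hτ⟩ := (subst_substRel_iff.1 ht).exists_subst (hll ρ hρ)
    exact ⟨_, .root ρ hρ τ,
      subst_substRel_iff.2 (substRel_subst fun x hx => hτ x (ρ.vars_rhs_subset hx))⟩
  | arg f ts i u _ ih =>
    rintro _ ⟨us, rfl, hus⟩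
    obtain ⟨u', hstep, hu'⟩ := ih (hus i)
    refine ⟨_, .arg f us i u' hstep, _, rfl, fun j => ?_⟩
    rcases eq_or_ne j i with rfl | hj
    · simpa only [Function.update_self] using hu'
    · simpa only [Function.update_of_ne hj] using hus j

/-- Many-step rewriting on the terms over `W`. -/
abbrev Steps (R : TRS L V) : L.Term W → L.Term W → Prop := ReflTransGen (StepOver R)

theorem Steps.subst {t u : L.Term W} (h : Steps R t u) (τ : W → L.Term X) :
    Steps R (t.subst τ) (u.subst τ) :=
  ReflTransGen.lift (fun t : L.Term W => t.subst τ) (fun _ _ h => StepOver.subst h τ) _ _ h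

theorem Steps.vars_subset {t u : L.Term W} (h : Steps R t u) : vars u ⊆ vars t := by
  induction h with
  | refl => exact subset_rfl
  | tail _ h ih => exact h.vars_subset.trans ih

theorem Steps.update {n : ℕ} (f : L.Functions n) (ts : Fin n → L.Term W) (i : Fin n)
    {t u : L.Term W} (h : Steps R t u) :
    Steps R (Term.func f (Function.update ts i t)) (Term.func f (Function.update ts i u)) := by
  refine ReflTransGen.lift (fun t => Term.func f (Function.update ts i t)) (fun a b h => ?_)
    _ _ h
  simpa only [Function.update_idem] using
    StepOver.arg f (Function.update ts i a) i b (by rwa [Function.update_self])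

theorem Steps.func {n : ℕ} (f : L.Functions n) {ts us : Fin n → L.Term W}
    (h : ∀ i, Steps R (ts i) (us i)) : Steps R (Term.func f ts) (Term.func f us) := by
  classical
  suffices ∀ s : Finset (Fin n), Steps R (Term.func f ts) (Term.func f (s.piecewise us ts)) by
    simpa only [Finset.piecewise_univ] using this Finset.univ
  intro s
  induction s using Finset.induction_on with
  | empty => rw [Finset.piecewise_empty]
  | insert i s hi ih =>
    rw [Finset.piecewise_insert]
    have := Steps.update f (s.piecewise us ts) i (h i)
    rw [← Finset.piecewise_eq_of_notMem s us ts hi, Function.update_eq_self] at this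
    exact ih.trans this

theorem Steps.exists_substRel (hll : LeftLinear R) {B : W → L.Term X → Prop} {t u : L.Term W}
    (h : Steps R t u) {t' : L.Term X} (ht : SubstRel B t t') :
    ∃ u', Steps R t' u' ∧ SubstRel B u u' := by
  induction h with
  | refl => exact ⟨t', .refl, ht⟩
  | tail _ h ih =>
    obtain ⟨v, ht'v, hv⟩ := ih
    obtain ⟨u', hvu', hu'⟩ := h.exists_substRel hll hv
    exact ⟨u', ht'v.tail hvu', hu'⟩

theorem SubstRel.steps_subst {B : U → L.Term W → Prop} {σ : U → L.Term X} {τ : W → L.Term X}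
    (hB : ∀ x u, B x u → Steps R (σ x) (u.subst τ)) : ∀ {t : L.Term U} {u : L.Term W},
      SubstRel B t u → Steps R (t.subst σ) (u.subst τ)
  | .var x, u, h => hB x u h
  | .func f _, _, h => by
      obtain ⟨us, rfl, hus⟩ := h
      exact Steps.func f fun i => (hus i).steps_subst hB

theorem ConfluentAt.of_rename {e : W → X} {t : L.Term W} (he : Set.InjOn e (vars t))
    (h : ConfluentAt (StepOver R) (t.subst fun x => Term.var (e x))) :
    ConfluentAt (StepOver R) t := by
  let g : X → L.Term W :=
    Function.extend ((vars t).domRestrict e) (fun x => Term.var x.1) fun _ => t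
  have back : ∀ {s : L.Term W}, vars s ⊆ vars t →
      (s.subst fun x => Term.var (e x)).subst g = s := by
    intro s hs
    rw [subst_subst]
    refine (subst_congr fun x hx => ?_).trans (subst_var s)
    exact he.injective.extend_apply (fun x : vars t => Term.var x.1) (fun _ => t) ⟨x, hs hx⟩
  intro u v hu hv
  obtain ⟨d, hud, hvd⟩ := h _ _ (Steps.subst hu _) (Steps.subst hv _)
  refine ⟨d.subst g, ?_, ?_⟩
  · exact back (Steps.vars_subset hu) ▸ Steps.subst hud g
  · exact back (Steps.vars_subset hv) ▸ Steps.subst hvd g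

end Steps

section Rank

variable {L : FirstOrder.Language.{u, v}} {V : Type w} {S : Type z} {W X : Type*}

/-- The sort of the root of a term, where `ω` gives the sorts of the variables. -/
def SortAttachment.topSort (𝒮 : SortAttachment L V S) (ω : W → S) : L.Term W → S
  | .var x => ω x
  | .func f _ => 𝒮.resSort f

variable [PartialOrder S]

open Classical in
/-- The contribution to the rank of a subterm with root sort `α` that stands where a term of sort at
most `γ` is expected. The value `γ = ⊤` means that there is no expectation. -/
noncomputable def misfit (γ : WithTop S) (α : S) : ℕ :=
  if (α : WithTop S) ≤ γ then 0 else 1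

/-- The rank of a term that stands where a term of sort at most `γ` is expected: the largest number
of ill-sorted arguments on a path from the root to a leaf. A variable `x` stands for a term of sort
`ω x` and rank `wt x`. -/
noncomputable def SortAttachment.rankAt (𝒮 : SortAttachment L V S) (ω : W → S) (wt : W → ℕ) :
    WithTop S → L.Term W → ℕ
  | γ, .var x => wt x + misfit γ (ω x)
  | γ, .func f ts =>
      (Finset.univ.sup fun i => 𝒮.rankAt ω wt (𝒮.argSort f i) (ts i)) + misfit γ (𝒮.resSort f)

variable {𝒮 : SortAttachment L V S} {ω : W → S} {wt : W → ℕ} {γ δ : WithTop S} {α : S}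

theorem misfit_of_le (h : (α : WithTop S) ≤ γ) : misfit γ α = 0 := if_pos h

theorem misfit_of_not_le (h : ¬(α : WithTop S) ≤ γ) : misfit γ α = 1 := if_neg h

theorem misfit_le_one (γ : WithTop S) (α : S) : misfit γ α ≤ 1 := by
  unfold misfit; split_ifs <;> simp

theorem misfit_anti (h : γ ≤ δ) (α : S) : misfit δ α ≤ misfit γ α := by
  by_cases hα : (α : WithTop S) ≤ γ
  · rw [misfit_of_le (hα.trans h)]
    exact Nat.zero_le _
  · rw [misfit_of_not_le hα]
    exact misfit_le_one δ α

theorem rankAt_eq_add_misfit (γ : WithTop S) (t : L.Term W) :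
    𝒮.rankAt ω wt γ t = 𝒮.rankAt ω wt ⊤ t + misfit γ (𝒮.topSort ω t) := by
  cases t <;> simp only [SortAttachment.rankAt, SortAttachment.topSort, misfit_of_le le_top,
    Nat.add_zero]

theorem rankAt_of_le {t : L.Term W} (h : (𝒮.topSort ω t : WithTop S) ≤ γ) :
    𝒮.rankAt ω wt γ t = 𝒮.rankAt ω wt ⊤ t := by
  rw [rankAt_eq_add_misfit, misfit_of_le h, Nat.add_zero]

theorem rankAt_of_not_le {t : L.Term W} (h : ¬(𝒮.topSort ω t : WithTop S) ≤ γ) :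
    𝒮.rankAt ω wt γ t = 𝒮.rankAt ω wt ⊤ t + 1 := by
  rw [rankAt_eq_add_misfit, misfit_of_not_le h]

theorem rankAt_anti (h : γ ≤ δ) (t : L.Term W) : 𝒮.rankAt ω wt δ t ≤ 𝒮.rankAt ω wt γ t := by
  rw [rankAt_eq_add_misfit δ, rankAt_eq_add_misfit γ]
  exact Nat.add_le_add_left (misfit_anti h _) _

theorem rankAt_arg_le (γ : WithTop S) {n : ℕ} (f : L.Functions n) (ts : Fin n → L.Term W)
    (i : Fin n) :
    𝒮.rankAt ω wt (𝒮.argSort f i) (ts i) ≤ 𝒮.rankAt ω wt γ (Term.func f ts) :=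
  (Finset.le_sup (f := fun i => 𝒮.rankAt ω wt (𝒮.argSort f i) (ts i)) (Finset.mem_univ i)).trans
    (Nat.le_add_right _ _)

theorem rankAt_func_le_max {n : ℕ} (f : L.Functions n) {ts us vs : Fin n → L.Term W}
    (h : ∀ i, 𝒮.rankAt ω wt (𝒮.argSort f i) (ts i) ≤
      max (𝒮.rankAt ω wt (𝒮.argSort f i) (us i)) (𝒮.rankAt ω wt (𝒮.argSort f i) (vs i)))
    (γ : WithTop S) :
    𝒮.rankAt ω wt γ (Term.func f ts) ≤
      max (𝒮.rankAt ω wt γ (Term.func f us)) (𝒮.rankAt ω wt γ (Term.func f vs)) := by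
  simp only [SortAttachment.rankAt, max_add_add_right]
  refine Nat.add_le_add_right ?_ _
  rw [← Finset.sup_sup]
  exact Finset.sup_mono_fun fun i _ => h i

theorem rankAt_func_mono {n : ℕ} (f : L.Functions n) {ts us : Fin n → L.Term W}
    (h : ∀ i, 𝒮.rankAt ω wt (𝒮.argSort f i) (ts i) ≤ 𝒮.rankAt ω wt (𝒮.argSort f i) (us i))
    (γ : WithTop S) :
    𝒮.rankAt ω wt γ (Term.func f ts) ≤ 𝒮.rankAt ω wt γ (Term.func f us) := by
  simpa only [max_self] using
    rankAt_func_le_max f (us := us) (vs := us) (fun i => (h i).trans (max_self _).ge) γ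

theorem rankAt_update_le {n : ℕ} (f : L.Functions n) {ts : Fin n → L.Term W} {i : Fin n}
    {u : L.Term W} (h : ∀ γ, 𝒮.rankAt ω wt γ u ≤ 𝒮.rankAt ω wt γ (ts i)) :
    ∀ γ, 𝒮.rankAt ω wt γ (Term.func f (Function.update ts i u)) ≤
      𝒮.rankAt ω wt γ (Term.func f ts) := by
  refine rankAt_func_mono f fun j => ?_
  rcases eq_or_ne j i with rfl | hj
  · rw [Function.update_self]
    exact h _
  · rw [Function.update_of_ne hj]

theorem rankAt_rename (ω : X → S) (wt : X → ℕ) (e : W → X) :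
    ∀ (γ : WithTop S) (t : L.Term W), 𝒮.rankAt ω wt γ (t.subst fun x => Term.var (e x)) =
      𝒮.rankAt (fun x => ω (e x)) (fun x => wt (e x)) γ t
  | _, .var _ => rfl
  | _, .func _ _ => by simp only [Term.subst, SortAttachment.rankAt, rankAt_rename ω wt e]

theorem rankAt_mono_weight {wt' : W → ℕ} (h : wt ≤ wt') :
    ∀ (γ : WithTop S) (t : L.Term W), 𝒮.rankAt ω wt γ t ≤ 𝒮.rankAt ω wt' γ t
  | _, .var x => Nat.add_le_add_right (h x) _
  | _, .func _ ts => Nat.add_le_add_right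
      (Finset.sup_mono_fun fun i _ => rankAt_mono_weight h _ (ts i)) _

theorem hasSort_topSort_of_rankAt_eq_zero : ∀ {t : L.Term V},
    𝒮.rankAt 𝒮.varSort 0 ⊤ t = 0 → 𝒮.HasSort t (𝒮.topSort 𝒮.varSort t)
  | .var x, _ => .var x
  | .func f ts, h => by
      have harg : ∀ i, 𝒮.rankAt 𝒮.varSort 0 (𝒮.argSort f i) (ts i) = 0 := fun i =>
        Nat.le_zero.1 ((rankAt_arg_le ⊤ f ts i).trans h.le)
      refine .func f ts _ (fun i => hasSort_topSort_of_rankAt_eq_zero <|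
        Nat.le_zero.1 ((rankAt_anti le_top _).trans (harg i).le)) fun i => ?_
      by_contra hi
      have := harg i
      rw [rankAt_of_not_le (by rwa [WithTop.coe_le_coe])] at this
      exact Nat.succ_ne_zero _ this

end Rank

section RankDecrease

variable {L : FirstOrder.Language.{u, v}} {V : Type w} {S : Type z} [PartialOrder S] {W : Type*}
  {𝒮 : SortAttachment L V S} {R : TRS L V} {ω : W → S} {wt : W → ℕ} {σ : V → L.Term W}

theorem topSort_subst {t : L.Term V} {α : S} (h : 𝒮.HasSort t α) (ht : ∀ x, t ≠ Term.var x) :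
    𝒮.topSort ω (t.subst σ) = α := by
  cases h with
  | var x => exact (ht x rfl).elim
  | func => rfl

theorem rankAt_subst_le {t : L.Term V} {α : S} (ht : 𝒮.HasSort t α) {N : ℕ}
    (h : ∀ x ∈ vars t, 𝒮.rankAt ω wt (𝒮.varSort x) (σ x) ≤ N) :
    𝒮.rankAt ω wt α (t.subst σ) ≤ N := by
  induction ht with
  | var x => exact h x rfl
  | func f ts β _ hβ ih =>
    rw [rankAt_of_le (le_refl (𝒮.resSort f : WithTop S)), Term.subst, SortAttachment.rankAt,
      misfit_of_le le_top, Nat.add_zero]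
    exact Finset.sup_le fun i _ => (rankAt_anti (WithTop.coe_le_coe.2 (hβ i)) _).trans
      (ih i fun x hx => h x (Set.mem_iUnion.2 ⟨i, hx⟩))

theorem rankAt_le_rankAt_subst {x : V} : ∀ {t : L.Term V}, 𝒮.StrictlySorted t →
    (∀ y, t ≠ Term.var y) → x ∈ vars t →
      𝒮.rankAt ω wt (𝒮.varSort x) (σ x) ≤ 𝒮.rankAt ω wt ⊤ (t.subst σ)
  | .var y, _, h, _ => (h y rfl).elim
  | .func f ts, hs, _, hx => by
      obtain ⟨i, hi⟩ := Set.mem_iUnion.1 hx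
      obtain ⟨hvar, hsi⟩ := hs i
      refine le_trans ?_ (rankAt_arg_le ⊤ f (fun i => (ts i).subst σ) i)
      by_cases hv : ∃ y, ts i = Term.var y
      · obtain ⟨y, hy⟩ := hv
        rw [hy] at hi
        obtain rfl : x = y := hi
        rw [hvar x hy, hy]
        rfl
      · push Not at hv
        exact (rankAt_le_rankAt_subst hsi hv hi).trans (rankAt_anti le_top _)

theorem rankAt_rhs_subst_le (hR : 𝒮.Compatible R) {ρ : Rule L V} (hρ : ρ ∈ R) (γ : WithTop S) :
    𝒮.rankAt ω wt γ (ρ.rhs.subst σ) ≤ 𝒮.rankAt ω wt γ (ρ.lhs.subst σ) := by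
  obtain ⟨α, β, hl, hr, hβα, hs⟩ := hR ρ hρ
  have key : 𝒮.rankAt ω wt β (ρ.rhs.subst σ) ≤ 𝒮.rankAt ω wt ⊤ (ρ.lhs.subst σ) :=
    rankAt_subst_le hr fun x hx =>
      rankAt_le_rankAt_subst hs ρ.lhs_ne_var (ρ.vars_rhs_subset hx)
  by_cases hγ : (α : WithTop S) ≤ γ
  · calc 𝒮.rankAt ω wt γ (ρ.rhs.subst σ)
        ≤ 𝒮.rankAt ω wt β (ρ.rhs.subst σ) := rankAt_anti ((WithTop.coe_le_coe.2 hβα).trans hγ) _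
      _ ≤ 𝒮.rankAt ω wt ⊤ (ρ.lhs.subst σ) := key
      _ ≤ 𝒮.rankAt ω wt γ (ρ.lhs.subst σ) := rankAt_anti le_top _
  · calc 𝒮.rankAt ω wt γ (ρ.rhs.subst σ)
        ≤ 𝒮.rankAt ω wt ⊤ (ρ.rhs.subst σ) + 1 := by
          rw [rankAt_eq_add_misfit]
          exact Nat.add_le_add_left (misfit_le_one γ _) _
      _ ≤ 𝒮.rankAt ω wt ⊤ (ρ.lhs.subst σ) + 1 :=
          Nat.add_le_add_right ((rankAt_anti le_top _).trans key) 1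
      _ = 𝒮.rankAt ω wt γ (ρ.lhs.subst σ) :=
          (rankAt_of_not_le (by rwa [topSort_subst hl ρ.lhs_ne_var])).symm

theorem StepOver.rankAt_le (hR : 𝒮.Compatible R) {t u : L.Term W} (h : StepOver R t u) :
    ∀ γ, 𝒮.rankAt ω wt γ u ≤ 𝒮.rankAt ω wt γ t := by
  induction h with
  | root ρ hρ σ => exact rankAt_rhs_subst_le hR hρ
  | arg f ts i u _ ih => exact rankAt_update_le f ih

theorem Steps.rankAt_le (hR : 𝒮.Compatible R) {t u : L.Term W} (h : Steps R t u)
    (γ : WithTop S) : 𝒮.rankAt ω wt γ u ≤ 𝒮.rankAt ω wt γ t := by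
  induction h with
  | refl => exact le_rfl
  | tail _ h ih => exact (h.rankAt_le hR γ).trans ih

end RankDecrease

section Renaming

theorem exists_injOn_forall_mem {ι α : Type*} {s : ι → Set α} (hs : ∀ i, (s i).Infinite)
    {F : Set ι} (hF : F.Finite) : ∃ e : ι → α, (∀ i, e i ∈ s i) ∧ Set.InjOn e F := by
  classical
  induction F, hF using Set.Finite.induction_on with
  | empty =>
    choose e he using fun i => (hs i).nonempty
    exact ⟨e, he, Set.injOn_empty e⟩
  | @insert a F ha hF ih =>
    obtain ⟨e, he, hinj⟩ := ih
    obtain ⟨y, hy, hyF⟩ := ((hs a).sdiff (hF.image e)).nonempty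
    have heq : Set.EqOn e (Function.update e a y) F := fun x hx =>
      (Function.update_of_ne (ne_of_mem_of_not_mem hx ha) y e).symm
    refine ⟨Function.update e a y, fun i => ?_, (Set.injOn_insert ha).2 ⟨hinj.congr heq, ?_⟩⟩
    · rcases eq_or_ne i a with rfl | hi
      · rwa [Function.update_self]
      · rw [Function.update_of_ne hi]
        exact he i
    · rwa [Function.update_self, ← heq.image_eq]

variable {L : FirstOrder.Language.{u, v}} {V : Type w} {S : Type z} [PartialOrder S] {W : Type*}

theorem confluentAt_of_rankAt_le {𝒮 : SortAttachment L V S}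
    (hV : ∀ α : S, (𝒮.varsOfSort α).Infinite) {R : TRS L V} {r : ℕ}
    (hr : ∀ t : L.Term V, 𝒮.rankAt 𝒮.varSort 0 ⊤ t ≤ r → ConfluentAt (StepOver R) t)
    {ω : W → S} {wt : W → ℕ} {t : L.Term W} (ht : 𝒮.rankAt ω wt ⊤ t ≤ r) :
    ConfluentAt (StepOver R) t := by
  obtain ⟨e, he, hinj⟩ := exists_injOn_forall_mem (fun x => hV (ω x)) (finite_vars t)
  refine .of_rename hinj (hr _ ?_)
  rw [rankAt_rename, show (fun x => 𝒮.varSort (e x)) = ω from funext he]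
  exact (rankAt_mono_weight (fun x => Nat.zero_le (wt x)) ⊤ t).trans ht

end Renaming

section Holes

variable {L : FirstOrder.Language.{u, v}} {V : Type w} {S : Type z} {R : TRS L V}

variable (L V S) in
/-- A hole has a sort and remembers its content, a term that need not have this sort. A hole term is
a term over holes; its variables are encoded as holes that contain themselves. -/
abbrev Hole := S × L.Term V

/-- Replace all holes by their contents. -/
def flatten (t : L.Term (Hole L V S)) : L.Term V := t.subst Prod.snd

/-- Regard a term as a hole term, in which only the variables are holes. -/
def SortAttachment.embed (𝒮 : SortAttachment L V S) (t : L.Term V) : L.Term (Hole L V S) :=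
  t.subst fun x => Term.var (𝒮.varSort x, Term.var x)

variable {𝒮 : SortAttachment L V S}

theorem flatten_embed (t : L.Term V) : flatten (𝒮.embed t) = t :=
  (subst_subst _ _ t).trans (subst_var t)

/-- Rewriting below a hole: it may rewrite its content, and may then be dissolved. -/
inductive SortAttachment.FillHole (𝒮 : SortAttachment L V S) (R : TRS L V) :
    Hole L V S → L.Term (Hole L V S) → Prop
  | rewrite {δ : S} {a b : L.Term V} (h : Steps R a b) :
      𝒮.FillHole R (δ, a) (Term.var (δ, b))
  | dissolve {δ : S} {a b : L.Term V} (h : Steps R a b) : 𝒮.FillHole R (δ, a) (𝒮.embed b)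

/-- Rewriting below some or all holes of a hole term, possibly dissolving them. -/
def SortAttachment.Fill (𝒮 : SortAttachment L V S) (R : TRS L V) :
    L.Term (Hole L V S) → L.Term (Hole L V S) → Prop :=
  SubstRel (𝒮.FillHole R)

theorem Fill.refl (t : L.Term (Hole L V S)) : 𝒮.Fill R t t :=
  substRel_refl (fun _ => .rewrite .refl) t

theorem Fill.update {n : ℕ} (f : L.Functions n) (ts : Fin n → L.Term (Hole L V S)) (i : Fin n)
    {u : L.Term (Hole L V S)} (h : 𝒮.Fill R (ts i) u) :
    𝒮.Fill R (Term.func f ts) (Term.func f (Function.update ts i u)) :=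
  SubstRel.update (fun _ => .rewrite .refl) f ts i h

theorem Fill.steps_flatten {t u : L.Term (Hole L V S)} (h : 𝒮.Fill R t u) :
    Steps R (flatten t) (flatten u) := by
  refine SubstRel.steps_subst (fun x u hu => ?_) h
  rcases hu with hb | @⟨δ, a, b, hb⟩
  · exact hb
  · change Steps R a (flatten (𝒮.embed b))
    rwa [flatten_embed]

variable [PartialOrder S]

/-- The rank of a term over the variables of the sort attachment. -/
noncomputable abbrev SortAttachment.rank (𝒮 : SortAttachment L V S) (t : L.Term V) : ℕ :=
  𝒮.rankAt 𝒮.varSort 0 ⊤ t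

/-- The rank of a hole term, where a hole counts as a variable that weighs as much as its
content. -/
noncomputable abbrev SortAttachment.holeRankAt (𝒮 : SortAttachment L V S) :
    WithTop S → L.Term (Hole L V S) → ℕ :=
  𝒮.rankAt Prod.fst fun h => 𝒮.rank h.2

theorem holeRankAt_embed (γ : WithTop S) (t : L.Term V) :
    𝒮.holeRankAt γ (𝒮.embed t) = 𝒮.rankAt 𝒮.varSort 0 γ t := by
  have rank_var : (fun x => 𝒮.rank (Term.var x)) = 0 :=
    funext fun x => misfit_of_le (α := 𝒮.varSort x) le_top
  rw [← rank_var]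
  exact rankAt_rename _ _ _ γ t

theorem FillHole.join (hR : 𝒮.Compatible R) {δ : S} {a : L.Term V}
    (ha : ConfluentAt (StepOver R) a) {u v : L.Term (Hole L V S)} (hu : 𝒮.FillHole R (δ, a) u)
    (hv : 𝒮.FillHole R (δ, a) v) :
    ∃ u' v' d, 𝒮.Fill R u u' ∧ Steps R u' d ∧ 𝒮.Fill R v v' ∧ Steps R v' d ∧ ∀ γ,
      max (𝒮.holeRankAt γ u') (𝒮.holeRankAt γ v') ≤ max (𝒮.holeRankAt γ u) (𝒮.holeRankAt γ v) := by
  have embed_le : ∀ {b c : L.Term V}, Steps R b c → ∀ γ,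
      𝒮.holeRankAt γ (𝒮.embed c) ≤ 𝒮.holeRankAt γ (𝒮.embed b) := fun h γ =>
    (Steps.subst h _).rankAt_le hR γ
  rcases hu with @⟨_, _, b, hb⟩ | @⟨_, _, b, hb⟩ <;>
    rcases hv with @⟨_, _, c, hc⟩ | @⟨_, _, c, hc⟩ <;> obtain ⟨e, hbe, hce⟩ := ha b c hb hc
  · have hole_le : ∀ γ, 𝒮.holeRankAt γ (Term.var (δ, e)) ≤ 𝒮.holeRankAt γ (Term.var (δ, b)) :=
      fun γ => Nat.add_le_add_right (Steps.rankAt_le hR hbe ⊤) _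
    exact ⟨Term.var (δ, e), Term.var (δ, e), _, .rewrite hbe, .refl, .rewrite hce, .refl,
      fun γ => (max_self _).le.trans ((hole_le γ).trans (le_max_left _ _))⟩
  · exact ⟨𝒮.embed e, 𝒮.embed c, _, .dissolve hbe, .refl, Fill.refl _, Steps.subst hce _,
      fun γ => (max_le (embed_le hce γ) le_rfl).trans (le_max_right _ _)⟩
  · exact ⟨𝒮.embed b, 𝒮.embed e, _, Fill.refl _, Steps.subst hbe _, .dissolve hce, .refl,
      fun γ => (max_le le_rfl (embed_le hbe γ)).trans (le_max_left _ _)⟩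
  · exact ⟨𝒮.embed b, 𝒮.embed c, _, Fill.refl _, Steps.subst hbe _, Fill.refl _,
      Steps.subst hce _, fun γ => le_rfl⟩

theorem Fill.join (hR : 𝒮.Compatible R) {r : ℕ}
    (hr : ∀ t, 𝒮.rank t ≤ r → ConfluentAt (StepOver R) t) :
    ∀ {t u v : L.Term (Hole L V S)}, 𝒮.holeRankAt ⊤ t ≤ r → 𝒮.Fill R t u → 𝒮.Fill R t v →
      ∃ u' v' d, 𝒮.Fill R u u' ∧ Steps R u' d ∧ 𝒮.Fill R v v' ∧ Steps R v' d ∧ ∀ γ,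
        max (𝒮.holeRankAt γ u') (𝒮.holeRankAt γ v') ≤
          max (𝒮.holeRankAt γ u) (𝒮.holeRankAt γ v)
  | .var (_, a), _, _, ht, hu, hv =>
      FillHole.join hR (hr a ((Nat.le_add_right _ _).trans ht)) hu hv
  | .func f ts, _, _, ht, hu, hv => by
      obtain ⟨us, rfl, hus⟩ := hu
      obtain ⟨vs, rfl, hvs⟩ := hv
      have hts : ∀ i, 𝒮.holeRankAt ⊤ (ts i) ≤ r := fun i =>
        (rankAt_anti le_top _).trans ((rankAt_arg_le ⊤ f ts i).trans ht)
      choose us' vs' ds hus' huds hvs' hvds hle using fun i =>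
        Fill.join hR hr (hts i) (hus i) (hvs i)
      exact ⟨Term.func f us', Term.func f vs', Term.func f ds, ⟨_, rfl, hus'⟩, Steps.func f huds,
        ⟨_, rfl, hvs'⟩, Steps.func f hvds, fun γ => max_le
          (rankAt_func_le_max f (fun i => (le_max_left _ _).trans (hle i _)) γ)
          (rankAt_func_le_max f (fun i => (le_max_right _ _).trans (hle i _)) γ)⟩

open Classical in
/-- Dissolve all holes whose contents fit where they stand, with a sort of at most `γ` expected at
the root. -/
noncomputable def SortAttachment.fillFitting (𝒮 : SortAttachment L V S) :
    WithTop S → L.Term (Hole L V S) → L.Term (Hole L V S)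
  | γ, .var (δ, a) => if (𝒮.topSort 𝒮.varSort a : WithTop S) ≤ γ then 𝒮.embed a else .var (δ, a)
  | _, .func f ts => .func f fun i => 𝒮.fillFitting (𝒮.argSort f i) (ts i)

theorem fill_fillFitting : ∀ (γ : WithTop S) (t : L.Term (Hole L V S)),
    𝒮.Fill R t (𝒮.fillFitting γ t)
  | γ, .var (δ, a) => by
      rw [SortAttachment.fillFitting]
      split_ifs
      · exact .dissolve .refl
      · exact .rewrite .refl
  | _, .func f ts => ⟨_, by rw [SortAttachment.fillFitting], fun i => fill_fillFitting _ (ts i)⟩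

theorem flatten_fillFitting : ∀ (γ : WithTop S) (t : L.Term (Hole L V S)),
    flatten (𝒮.fillFitting γ t) = flatten t
  | γ, .var (δ, a) => by
      rw [SortAttachment.fillFitting]
      split_ifs
      · exact flatten_embed a
      · rfl
  | _, .func f ts => by
      rw [SortAttachment.fillFitting]
      exact congrArg (Term.func f) <| funext fun i => flatten_fillFitting _ (ts i)

theorem holeRankAt_fillFitting_le : ∀ (γ : WithTop S) (t : L.Term (Hole L V S)),
    𝒮.holeRankAt γ (𝒮.fillFitting γ t) ≤ 𝒮.holeRankAt γ t
  | γ, .var (δ, a) => by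
      rw [SortAttachment.fillFitting]
      split_ifs with h
      · rw [holeRankAt_embed, rankAt_of_le h]
        exact Nat.le_add_right _ _
      · exact le_rfl
  | γ, .func f ts => by
      rw [SortAttachment.fillFitting]
      exact rankAt_func_mono f (fun i => holeRankAt_fillFitting_le _ (ts i)) γ

theorem substRel_fillFitting {u : L.Term V} {β : S} (hu : 𝒮.HasSort u β) {σ : V → L.Term V} :
    ∀ {γ : WithTop S} {t : L.Term (Hole L V S)}, (β : WithTop S) ≤ γ → flatten t = u.subst σ →
      SubstRel (fun x v => flatten v = σ x) u (𝒮.fillFitting γ t) := by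
  induction hu with
  | var x => exact fun _ ht => (flatten_fillFitting _ _).trans ht
  | func f ts β hts hβ ih =>
    intro γ t hγ ht
    rcases t with ⟨δ, a⟩ | ⟨g, cs⟩
    · obtain rfl : a = (Term.func f ts).subst σ := ht
      have hfit : (𝒮.topSort 𝒮.varSort ((Term.func f ts).subst σ) : WithTop S) ≤ γ := hγ
      rw [SortAttachment.fillFitting, if_pos hfit, SortAttachment.embed, subst_subst]
      exact substRel_subst fun x _ => flatten_embed (σ x)
    · simp only [flatten, Term.subst, Term.func.injEq] at ht
      obtain ⟨rfl, hgf, hcs⟩ := ht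
      cases hgf
      rw [SortAttachment.fillFitting]
      exact ⟨_, rfl, fun i =>
        ih i (WithTop.coe_le_coe.2 (hβ i)) (congrFun (eq_of_heq hcs) i)⟩

theorem exists_fill_step_root (hR : 𝒮.Compatible R) (hll : LeftLinear R) {ρ : Rule L V}
    (hρ : ρ ∈ R) {σ : V → L.Term V} {n : ℕ} {f : L.Functions n}
    {ts : Fin n → L.Term (Hole L V S)} (h : flatten (Term.func f ts) = ρ.lhs.subst σ) :
    ∃ t' u', 𝒮.Fill R (Term.func f ts) t' ∧
      (∀ γ, 𝒮.holeRankAt γ t' ≤ 𝒮.holeRankAt γ (Term.func f ts)) ∧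
      StepOver R t' u' ∧ flatten u' = ρ.rhs.subst σ := by
  obtain ⟨α, -, hl, -⟩ := hR ρ hρ
  obtain ⟨τ, hτ, hτσ⟩ := (substRel_fillFitting hl le_top h).exists_subst (hll ρ hρ)
  refine ⟨𝒮.fillFitting ⊤ (Term.func f ts), ρ.rhs.subst τ, fill_fillFitting ⊤ _, fun γ => ?_,
    hτ ▸ .root ρ hρ τ, ?_⟩
  · simpa only [SortAttachment.fillFitting] using holeRankAt_fillFitting_le γ (Term.func f ts)
  · exact (subst_subst _ _ _).trans (subst_congr fun x hx => hτσ x (ρ.vars_rhs_subset hx))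

theorem exists_fill_steps (hR : 𝒮.Compatible R) (hll : LeftLinear R) :
    ∀ {t : L.Term (Hole L V S)} {u : L.Term V}, StepOver R (flatten t) u →
      ∃ t' u', 𝒮.Fill R t t' ∧ (∀ γ, 𝒮.holeRankAt γ t' ≤ 𝒮.holeRankAt γ t) ∧
        Steps R t' u' ∧ flatten u' = u
  | .var (δ, a), u, h =>
      ⟨Term.var (δ, u), _, .rewrite (.single h),
        fun _ => Nat.add_le_add_right (StepOver.rankAt_le hR h ⊤) _, .refl, rfl⟩
  | .func f ts, u, h => by
      generalize hs : flatten (Term.func f ts) = s at h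
      cases h with
      | root ρ hρ σ =>
        obtain ⟨t', u', hfill, hle, hstep, hu'⟩ := exists_fill_step_root hR hll hρ hs
        exact ⟨t', u', hfill, hle, .single hstep, hu'⟩
      | arg g us i v h =>
        simp only [flatten, Term.subst, Term.func.injEq] at hs
        obtain ⟨rfl, hfg, hus⟩ := hs
        cases hfg
        cases hus
        obtain ⟨t', u', hfill, hle, hsteps, rfl⟩ := exists_fill_steps hR hll h
        exact ⟨_, _, Fill.update f ts i hfill, rankAt_update_le f hle,
          Steps.update f ts i hsteps, congrArg (Term.func f) (subst_update _ ts i u')⟩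

open Classical in
/-- Turn every maximal ill-sorted argument of a term into a hole of the expected sort. -/
noncomputable def SortAttachment.abstractAliens (𝒮 : SortAttachment L V S) :
    L.Term V → L.Term (Hole L V S)
  | .var x => .var (𝒮.varSort x, .var x)
  | .func f ts => .func f fun i =>
      if 𝒮.topSort 𝒮.varSort (ts i) ≤ 𝒮.argSort f i then 𝒮.abstractAliens (ts i)
      else .var (𝒮.argSort f i, ts i)

theorem flatten_abstractAliens : ∀ t : L.Term V, flatten (𝒮.abstractAliens t) = t
  | .var _ => by rw [SortAttachment.abstractAliens]; rfl
  | .func f ts => by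
      rw [SortAttachment.abstractAliens]
      refine congrArg (Term.func f) <| funext fun i => ?_
      beta_reduce
      split_ifs
      · exact flatten_abstractAliens (ts i)
      · rfl

theorem topSort_abstractAliens (t : L.Term V) :
    𝒮.topSort Prod.fst (𝒮.abstractAliens t) = 𝒮.topSort 𝒮.varSort t := by
  cases t <;> rw [SortAttachment.abstractAliens] <;> rfl

theorem holeRankAt_abstractAliens_le {r : ℕ} : ∀ {t : L.Term V}, 𝒮.rank t ≤ r + 1 →
    𝒮.holeRankAt ⊤ (𝒮.abstractAliens t) ≤ r
  | .var x, _ => by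
      rw [SortAttachment.abstractAliens]
      exact (holeRankAt_embed ⊤ (Term.var x)).le.trans
        ((misfit_of_le (α := 𝒮.varSort x) le_top).le.trans (Nat.zero_le r))
  | .func f ts, h => by
      rw [SortAttachment.abstractAliens, SortAttachment.holeRankAt, SortAttachment.rankAt,
        misfit_of_le le_top, Nat.add_zero]
      refine Finset.sup_le fun i _ => ?_
      have hi := (rankAt_arg_le ⊤ f ts i).trans h
      split_ifs with hfit
      · have hfit' : (𝒮.topSort Prod.fst (𝒮.abstractAliens (ts i)) : WithTop S) ≤
            𝒮.argSort f i := by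
          rwa [topSort_abstractAliens, WithTop.coe_le_coe]
        rw [rankAt_of_le hfit']
        exact holeRankAt_abstractAliens_le ((rankAt_anti le_top _).trans hi)
      · rw [rankAt_of_not_le (by rwa [WithTop.coe_le_coe])] at hi
        rw [rankAt_of_le (le_refl (𝒮.argSort f i : WithTop S))]
        exact Nat.le_of_succ_le_succ hi

end Holes

section Induction

variable {L : FirstOrder.Language.{u, v}} {V : Type w} {S : Type z} [PartialOrder S]
  {𝒮 : SortAttachment L V S} {R : TRS L V} {r : ℕ}

variable (𝒮 r) in
/-- The hole terms of rank at most `r`. -/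
abbrev BoundedHoleTerm := {t : L.Term (Hole L V S) // 𝒮.holeRankAt ⊤ t ≤ r}

/-- Rewriting of hole terms of rank at most `r`: a parallel step below the holes, followed by
rewriting that treats the holes as variables. -/
def FillSteps (R : TRS L V) : BoundedHoleTerm 𝒮 r → BoundedHoleTerm 𝒮 r → Prop :=
  Comp (fun t u : BoundedHoleTerm 𝒮 r => 𝒮.Fill R t.1 u.1) fun t u => Steps R t.1 u.1

theorem confluent_fillSteps (hV : ∀ α : S, (𝒮.varsOfSort α).Infinite) (hR : 𝒮.Compatible R)
    (hll : LeftLinear R) (hr : ∀ t, 𝒮.rank t ≤ r → ConfluentAt (StepOver R) t) :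
    Confluent (FillSteps R : BoundedHoleTerm 𝒮 r → BoundedHoleTerm 𝒮 r → Prop) := by
  have bound : ∀ {t u}, Steps R t u → 𝒮.holeRankAt ⊤ t ≤ r → 𝒮.holeRankAt ⊤ u ≤ r :=
    fun h ht => (Steps.rankAt_le hR h ⊤).trans ht
  refine confluent_comp_of_commute (fun h h' => ReflTransGen.trans h h') ?diamond ?commute ?peak
  case diamond =>
    intro t u v hu hv
    obtain ⟨d, hud, hvd⟩ := confluentAt_of_rankAt_le hV hr t.2 u.1 v.1 hu hv
    exact ⟨⟨d, bound hud u.2⟩, hud, hvd⟩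
  case commute =>
    intro t u v hu hv
    obtain ⟨d, hvd, hud⟩ := Steps.exists_substRel hll hu hv
    exact ⟨⟨d, bound hvd v.2⟩, hud, hvd⟩
  case peak =>
    intro t u v hu hv
    obtain ⟨u', v', d, huu', hu'd, hvv', hv'd, hle⟩ := Fill.join hR hr t.2 hu hv
    obtain ⟨hu', hv'⟩ := max_le_iff.1 ((hle ⊤).trans (max_le u.2 v.2))
    exact ⟨⟨d, bound hu'd hu'⟩, ⟨⟨u', hu'⟩, huu', hu'd⟩, ⟨⟨v', hv'⟩, hvv', hv'd⟩⟩

theorem confluentAt_of_rank_le_succ (hV : ∀ α : S, (𝒮.varsOfSort α).Infinite)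
    (hR : 𝒮.Compatible R) (hll : LeftLinear R)
    (hr : ∀ t, 𝒮.rank t ≤ r → ConfluentAt (StepOver R) t) {t : L.Term V}
    (ht : 𝒮.rank t ≤ r + 1) : ConfluentAt (StepOver R) t := by
  let C : BoundedHoleTerm 𝒮 r := ⟨𝒮.abstractAliens t, holeRankAt_abstractAliens_le ht⟩
  rw [show t = flatten C.1 from (flatten_abstractAliens t).symm]
  refine (confluent_fillSteps hV hR hll hr).confluentAt_of_simulation
    (fun C => flatten C.1) ?sound ?simulate C
  case sound =>
    rintro C D ⟨E, hCE, hED⟩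
    exact (Fill.steps_flatten hCE).trans (Steps.subst hED _)
  case simulate =>
    intro C u hu
    obtain ⟨t', u', hfill, hle, hsteps, rfl⟩ := exists_fill_steps hR hll hu
    have ht' := (hle ⊤).trans C.2
    exact ⟨⟨u', (hsteps.rankAt_le hR ⊤).trans ht'⟩, ⟨⟨t', ht'⟩, hfill, hsteps⟩, rfl⟩

theorem confluentAt_of_rank_le (hV : ∀ α : S, (𝒮.varsOfSort α).Infinite) (hR : 𝒮.Compatible R)
    (hll : LeftLinear R) (hconf : ConfluentOn (Step R) 𝒮.sortedTerms) :
    ∀ (r : ℕ) (t : L.Term V), 𝒮.rank t ≤ r → ConfluentAt (StepOver R) t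
  | 0, _, ht => stepOver_eq_step R ▸
      hconf.confluentAt ⟨_, hasSort_topSort_of_rankAt_eq_zero (Nat.le_zero.1 ht)⟩
  | r + 1, _, ht =>
      confluentAt_of_rank_le_succ hV hR hll (confluentAt_of_rank_le hV hR hll hconf r) ht

end Induction

end OrderSorted

theorem mainTheorem11_general {L : FirstOrder.Language.{u, v}} {V : Type w}
    {S : Type z} [PartialOrder S] (𝒮 : OrderSorted.SortAttachment L V S)
    (hV : ∀ α : S, (𝒮.varsOfSort α).Infinite) (R : OrderSorted.TRS L V)
    (hcompat : 𝒮.Compatible R) (hll : OrderSorted.LeftLinear R)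
    (hconf : OrderSorted.ConfluentOn (OrderSorted.Step R) 𝒮.sortedTerms) :
    OrderSorted.Confluent (OrderSorted.Step R) := by
  rw [← OrderSorted.stepOver_eq_step]
  exact fun t => OrderSorted.confluentAt_of_rank_le hV hcompat hll hconf (𝒮.rank t) t le_rfl

theorem mainTheorem11 {L : FirstOrder.Language.{u, v}} {V : Type w} [Countable V]
    {S : Type z} [PartialOrder S] (𝒮 : OrderSorted.SortAttachment L V S)
    (hV : ∀ α : S, (𝒮.varsOfSort α).Infinite) (R : OrderSorted.TRS L V)
    (hcompat : 𝒮.Compatible R) (hll : OrderSorted.LeftLinear R)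
    (hconf : OrderSorted.ConfluentOn (OrderSorted.Step R) 𝒮.sortedTerms) :
    OrderSorted.Confluent (OrderSorted.Step R) :=
  mainTheorem11_general 𝒮 hV R hcompat hll hconf
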